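/- Let $k$ be an algebraically closed field of characteristic $p\ge 0$, let $R=k[X_0,X_1,X_2]$, and let $I\subset R$ be an ideal of codimension (height) $2$ generated by a minimal generating set $f_0,\dots,f_3$ of homogeneous polynomials of the same degree $d$. Let $J(\mathbf f)=(\partial f_i/\partial X_j)$ be the $4\times 3$ Jacobian matrix and let $I_3(J(\mathbf f))$ be the ideal generated by its $3\times 3$ minors. Assume that $I_3(J(\mathbf f))\neq 0$ and that $p$ does not divide $d$. Let $\Gamma\subset\mathbb P^2_k\times\mathbb P^3_k$ be the closure of the graph of the rational map $\phi=(f_0:\dots:f_3):\mathbb P^2_k\dashrightarrow\mathbb P^3_k$; it is defined by the Rees algebra $\mathcal R_I=\bigoplus_{s\ge 0}I^s$, regarded as a quotient of $R[T_0,\dots,T_3]$ via $T_i\mapsto f_i$. Let $\pi:\Gamma\to\mathbb P^3_k$ be the projection. For a closed point $y\in\mathbb P^3_k$ the fiber is $\pi^{-1}(y)=\operatorname{Proj}(\mathcal R_I\otimes_{k[T_0,\dots,T_3]}k(y))\subset\mathbb P^2_k$. Let $\mathcal Y_1$ be the set of closed points $y\in\mathbb P^3_k$ with $\dim\pi^{-1}(y)=1$.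 Let $\operatorname{Syz}(I)=\{(a_0,\dots,a_3)\in R^4 : \sum_i a_if_i=0\}$, graded so that its component $\operatorname{Syz}(I)_\nu$ consists of the syzygies whose entries are forms of degree $\nu$, and let $\operatorname{indeg}(\operatorname{Syz}(I))=\inf\{\nu : \operatorname{Syz}(I)_\nu\neq 0\}$. Then $\mathcal Y_1$ is finite; for each $y\in\mathcal Y_1$ the unmixed one-dimensional part of $\pi^{-1}(y)$ is defined by a nonzero homogeneous polynomial $h_y\in R$ (unique up to a nonzero scalar); $\operatorname{indeg}(\operatorname{Syz}(I))$ is finite; and $$\sum_{y\in\mathcal Y_1}\deg h_y\;\le\;3(d-1)-\operatorname{indeg}(\operatorname{Syz}(I))\;<\;3(d-1).$$ -/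

import Mathlib

namespace RationalMapFibers

noncomputable section

open MvPolynomial LinearAlgebra.Projectivization

attribute [local instance] MvPolynomial.gradedAlgebra

/-- The ideal `I_s(M)` generated by the `s × s` minors of a matrix `M`. -/
def minorsIdeal {m n R : Type*} [CommRing R] (s : ℕ) (M : Matrix m n R) : Ideal R :=
  Ideal.span (Set.range fun rc : (Fin s ↪ m) × (Fin s ↪ n) => (M.submatrix rc.1 rc.2).det)

variable {k : Type*} [Field k] {σ ι : Type*}

/-- The base ideal `I = (f_i)`. -/
def baseIdeal (f : ι → MvPolynomial σ k) : Ideal (MvPolynomial σ k) :=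
  Ideal.span (Set.range f)

/-- The `f_i` are a minimal generating set of `I`: no `f_i` lies in the ideal generated by the
others, so no generator can be dropped. -/
def IsMinimalGeneratingSet (f : ι → MvPolynomial σ k) : Prop :=
  ∀ i, f i ∉ Ideal.span (f '' {i}ᶜ)

/-- The Jacobian matrix `J(f)`, with entry `∂ f_i / ∂ X_j` in row `i` and column `j`. -/
def jacobian (f : ι → MvPolynomial σ k) : Matrix ι σ (MvPolynomial σ k) :=
  Matrix.of fun i j => pderiv j (f i)

/-- The defining ideal of the Rees algebra of `I` (hence of the closure `Γ` of the graph of `φ`):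
with `R = k[X]`, it is the kernel of `R[T] → R[t]`, `T_i ↦ f_i t`, whose image is
`⨁ I ^ s t ^ s`. -/
def reesIdeal (f : ι → MvPolynomial σ k) : Ideal (MvPolynomial ι (MvPolynomial σ k)) :=
  RingHom.ker (aeval fun i => Polynomial.C (f i) * Polynomial.X :
    MvPolynomial ι (MvPolynomial σ k) →ₐ[MvPolynomial σ k] Polynomial (MvPolynomial σ k))

/-- The specialization `R[T] → R`, `T_i ↦ p_i`, at a vector `p` of scalars. -/
def specialize (p : ι → k) : MvPolynomial ι (MvPolynomial σ k) →+* MvPolynomial σ k :=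
  eval fun i => C (p i)

/-- The ideal of `R` obtained by specializing the Rees ideal at `T = p`. Writing the Rees algebra
as `R[T] / reesIdeal f`, the quotient of `R` by this ideal is the tensor product over `k[T]` of
the Rees algebra with `k`, where `T_i` acts on `k` as `p_i`. -/
def specializedIdeal (f : ι → MvPolynomial σ k) (p : ι → k) : Ideal (MvPolynomial σ k) :=
  (reesIdeal f).map (specialize p)

/-- The specialized ideal depends only on the point of projective space. -/
theorem specializedIdeal_smul_le (f : ι → MvPolynomial σ k) (p : ι → k) (t : k) :
    specializedIdeal f (t • p) ≤ specializedIdeal f p := by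
  unfold specializedIdeal
  rw [Ideal.map_le_iff_le_comap]
  intro G hG
  rw [Ideal.mem_comap]
  let τ : MvPolynomial ι (MvPolynomial σ k) →ₐ[MvPolynomial σ k]
      MvPolynomial ι (MvPolynomial σ k) := aeval fun i => C (C t) * X i
  have h1 : specialize (t • p) G = specialize p (τ G) := by
    have : (specialize (t • p) : MvPolynomial ι (MvPolynomial σ k) →+* _)
        = (specialize p).comp τ.toRingHom := by
      apply MvPolynomial.ringHom_ext
      · intro r; simp [specialize, τ]
      · intro i; simp [specialize, τ]
    rw [this]; rfl
  rw [h1]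
  apply Ideal.mem_map_of_mem
  have h0 : (aeval fun i => Polynomial.C (f i) * Polynomial.X :
      MvPolynomial ι (MvPolynomial σ k) →ₐ[MvPolynomial σ k] Polynomial (MvPolynomial σ k)) G
      = 0 := hG
  change (aeval fun i => Polynomial.C (f i) * Polynomial.X :
      MvPolynomial ι (MvPolynomial σ k) →ₐ[MvPolynomial σ k] Polynomial (MvPolynomial σ k)) (τ G)
      = 0
  have h2 : (aeval fun i => Polynomial.C (f i) * Polynomial.X :
      MvPolynomial ι (MvPolynomial σ k) →ₐ[MvPolynomial σ k] Polynomial (MvPolynomial σ k)).comp τ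
      = (Polynomial.aeval (Polynomial.C (C t) * Polynomial.X)).comp
        (aeval fun i => Polynomial.C (f i) * Polynomial.X) := by
    apply MvPolynomial.algHom_ext
    intro i
    simp [τ]
    ring
  have h3 := DFunLike.congr_fun h2 G
  simp only [AlgHom.comp_apply] at h3
  rw [h3, h0, map_zero]

/-- The homogeneous ideal defining the fiber `π⁻¹(y) = Proj (Rees(I) ⊗ k(y))` as a closed
subscheme of the projective space with coordinate ring `R`, for a closed point `y`
(a point with coordinates in `k`) of the target projective space. -/
def fiberIdeal (f : ι → MvPolynomial σ k) (y : ℙ k (ι → k)) : Ideal (MvPolynomial σ k) :=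
  Projectivization.lift (fun p : {v : ι → k // v ≠ 0} => specializedIdeal f p.1)
    (by
      rintro ⟨a, ha⟩ ⟨b, hb⟩ t h
      simp only at h
      subst h
      have ht : t ≠ 0 := fun h => ha (by simp [h])
      refine le_antisymm (specializedIdeal_smul_le f b t) ?_
      have := specializedIdeal_smul_le f (t • b) t⁻¹
      rwa [smul_smul, inv_mul_cancel₀ ht, one_smul] at this) y

/-- The underlying topological space of the fiber `π⁻¹(y)`, as a closed subset of
`Proj R`. -/
def fiber (f : ι → MvPolynomial σ k) (y : ℙ k (ι → k)) :
    Set (ProjectiveSpectrum (homogeneousSubmodule σ k)) :=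
  ProjectiveSpectrum.zeroLocus (homogeneousSubmodule σ k) (fiberIdeal f y)

/-- The set `𝒴_ℓ` of the closed points of the target whose fiber has dimension `ℓ`. -/
def pointsWithFiberDim (f : ι → MvPolynomial σ k) (ℓ : ℕ) : Set (ℙ k (ι → k)) :=
  {y | topologicalKrullDim (fiber f y) = ℓ}

/-- The unmixed part (of maximal dimension) of an ideal `J`: the intersection of the primary
components of `J` at its primes `P` of minimal height, the `P`-primary component being the
contraction of the extension of `J` to the localization at `P`. -/
def unmixedPart {R : Type*} [CommRing R] (J : Ideal R) : Ideal R :=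
  ⨅ P : {P : PrimeSpectrum R // P.asIdeal ∈ J.minimalPrimes ∧ P.asIdeal.height = J.height},
    (J.map (algebraMap R (Localization.AtPrime P.1.asIdeal))).comap
      (algebraMap R (Localization.AtPrime P.1.asIdeal))

/-- `h` is a defining equation of the unmixed part of the fiber `π⁻¹(y)`. -/
def IsUnmixedEquation (f : ι → MvPolynomial σ k) (y : ℙ k (ι → k)) (h : MvPolynomial σ k) :
    Prop :=
  Ideal.span {h} = unmixedPart (fiberIdeal f y)

/-- The degree `ν` part of `Syz(I) ⊆ R ^ (n + 1)`: the tuples `a` of forms of degree `ν` such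
that `∑ a_i f_i = 0`. -/
def syzygyPart [Fintype ι] (f : ι → MvPolynomial σ k) (ν : ℕ) :
    Submodule k (ι → MvPolynomial σ k) :=
  (LinearMap.ker (Fintype.linearCombination (MvPolynomial σ k) f)).restrictScalars k ⊓
    Submodule.pi Set.univ fun _ => homogeneousSubmodule σ k ν

/-- The initial degree of a graded module with components `M ν`: the infimum of the degrees `ν`
with `M ν ≠ 0`, equal to `⊤` if there is none. -/
def indeg {V : Type*} [AddCommGroup V] [Module k V] (M : ℕ → Submodule k V) : ℕ∞ :=
  ⨅ ν ∈ {ν : ℕ | M ν ≠ ⊥}, (ν : ℕ∞)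

end

end RationalMapFibers

open RationalMapFibers

/-! Write `h_y` for a generator of the unmixed part of the fiber ideal; since that ideal has height
one in a factorial ring, `h_y` is its gcd (`exists_unmixedPart_eq_span`). The fiber ideal contains
every `y_i f_j - y_j f_i`, so modulo `h_y` all the `f_l` are scalar multiples of one `f_m`.
Differentiating, the Jacobian matrix modulo `h_y` is a sum of two rank-one matrices, and `h_y`
divides its maximal minors (`dvd_signedMinor_jacobian`). A common factor of `h_y` and `h_z` with `y
≠ z` would divide every `f_l`, against codimension two, so the product `H` of finitely many `h_y`
still divides the minors.

By Cramer's rule the signed minors annihilate the columns of the Jacobian matrix, hence by Euler's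
identity, as `p ∤ d`, they form a syzygy of degree `3(d-1)`. Dividing by `H` leaves a nonzero syzygy
of degree `3(d-1) - deg H` (`sum_totalDegree_add_indeg_le`). The bound for finite sets of points
also gives finiteness. The strict inequality holds because minimality forbids syzygies of degree
zero. -/

namespace RationalMapFibers

open MvPolynomial

/-! ### Factors of homogeneous polynomials. -/

section Homogeneous

variable {σ k : Type*} [Field k]

/-- The homomorphism `R[X] → R[X][t]`, `X_i ↦ X_i t`, whose `t ^ n`-coefficient is the
homogeneous component of degree `n`. -/
noncomputable def gradingHom (σ k : Type*) [Field k] :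
    MvPolynomial σ k →ₐ[k] Polynomial (MvPolynomial σ k) :=
  aeval fun i => Polynomial.C (X i) * Polynomial.X

theorem gradingHom_monomial (m : σ →₀ ℕ) (r : k) :
    gradingHom σ k (monomial m r) = Polynomial.C (monomial m r) * Polynomial.X ^ m.degree := by
  rw [gradingHom, aeval_monomial, monomial_eq, Finsupp.prod, Finsupp.prod]
  simp only [mul_pow, Finset.prod_mul_distrib, Finset.prod_pow_eq_pow_sum, map_mul, map_prod,
    map_pow, Finsupp.degree_apply, mul_assoc]
  rfl

theorem coeff_gradingHom (a : MvPolynomial σ k) (n : ℕ) :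
    (gradingHom σ k a).coeff n = homogeneousComponent n a := by
  induction a using MvPolynomial.induction_on' with
  | monomial m r =>
    rw [gradingHom_monomial, Polynomial.coeff_C_mul_X_pow,
      homogeneousComponent_of_mem (isHomogeneous_monomial r rfl)]
  | add p q hp hq => rw [map_add, Polynomial.coeff_add, hp, hq, map_add]

theorem IsHomogeneous.gradingHom_eq {a : MvPolynomial σ k} {n : ℕ} (ha : a.IsHomogeneous n) :
    gradingHom σ k a = Polynomial.C a * Polynomial.X ^ n := by
  ext1 i
  rw [coeff_gradingHom, Polynomial.coeff_C_mul_X_pow, homogeneousComponent_of_mem ha]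

/-- Under `gradingHom` the product becomes a single power of `t` up to a coefficient. Degree and
trailing degree in `t` are both additive over a domain, so they must agree on each factor. -/
theorem isHomogeneous_of_mul {a b : MvPolynomial σ k} {n : ℕ} (h : (a * b).IsHomogeneous n)
    (hab : a * b ≠ 0) : a.IsHomogeneous a.totalDegree := by
  have ha : a ≠ 0 := left_ne_zero_of_mul hab
  have inj : ∀ c : MvPolynomial σ k, c ≠ 0 → gradingHom σ k c ≠ 0 := by
    intro c hc h0
    apply hc
    rw [← sum_homogeneousComponent c]
    exact Finset.sum_eq_zero fun i _ => by rw [← coeff_gradingHom, h0, Polynomial.coeff_zero]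
  have hA := inj a ha
  have hB := inj b (right_ne_zero_of_mul hab)
  have e := IsHomogeneous.gradingHom_eq h
  rw [map_mul] at e
  have e1 := congrArg Polynomial.natDegree e
  have e2 := congrArg Polynomial.natTrailingDegree e
  rw [Polynomial.natDegree_mul hA hB, Polynomial.natDegree_C_mul_X_pow _ _ hab] at e1
  rw [Polynomial.natTrailingDegree_mul hA hB, Polynomial.C_mul_X_pow_eq_monomial,
    Polynomial.natTrailingDegree_monomial hab] at e2
  have l1 := Polynomial.natTrailingDegree_le_natDegree (gradingHom σ k a)
  have l2 := Polynomial.natTrailingDegree_le_natDegree (gradingHom σ k b)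
  have key : ∀ i, i ≠ (gradingHom σ k a).natDegree → homogeneousComponent i a = 0 := by
    intro i hi
    rw [← coeff_gradingHom]
    rcases lt_or_gt_of_ne hi with hi | hi
    · exact Polynomial.coeff_eq_zero_of_lt_natTrailingDegree (by omega)
    · exact Polynomial.coeff_eq_zero_of_natDegree_lt hi
  have hom : a.IsHomogeneous (gradingHom σ k a).natDegree := by
    have s := sum_homogeneousComponent a
    by_cases hm : (gradingHom σ k a).natDegree ∈ Finset.range (a.totalDegree + 1)
    · have s' := (Finset.sum_eq_single_of_mem _ hm fun i _ hi => key i hi).symm.trans s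
      have t := homogeneousComponent_isHomogeneous (gradingHom σ k a).natDegree a
      rwa [s'] at t
    · exact absurd (s.symm.trans (Finset.sum_eq_zero fun i hi => key i
        fun h' => hm (h' ▸ hi))) ha
  rwa [hom.totalDegree ha]

theorem isHomogeneous_of_dvd {a c : MvPolynomial σ k} {n : ℕ} (h : c.IsHomogeneous n)
    (hc : c ≠ 0) (hac : a ∣ c) : a.IsHomogeneous a.totalDegree := by
  obtain ⟨b, rfl⟩ := hac
  exact isHomogeneous_of_mul h hc

theorem isUnit_of_totalDegree_eq_zero {a : MvPolynomial σ k} (ha : a ≠ 0)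
    (h : a.totalDegree = 0) : IsUnit a := by
  rw [totalDegree_eq_zero_iff_eq_C] at h
  rw [h] at ha ⊢
  exact (isUnit_iff_ne_zero.mpr fun h0 => ha (by rw [h0, map_zero])).map C

end Homogeneous

/-! ### From fiber dimension to height. -/

section Dimension

variable {σ k : Type*} [Field k]

attribute [local instance] MvPolynomial.gradedAlgebra

instance : QuasiSober (ProjectiveSpectrum (homogeneousSubmodule σ k)) :=
  inferInstanceAs (QuasiSober (AlgebraicGeometry.Proj (homogeneousSubmodule σ k)))

theorem exists_lt_of_one_le_topologicalKrullDim {X : Type*} [TopologicalSpace X] [QuasiSober X]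
    (h : 1 ≤ topologicalKrullDim X) : ∃ x y : X, x ⤳ y ∧ ¬ y ⤳ x := by
  obtain ⟨Z, W, hlt⟩ := Order.one_le_krullDim_iff.mp h
  obtain ⟨z, hz⟩ := QuasiSober.sober Z.2 Z.3
  obtain ⟨w, hw⟩ := QuasiSober.sober W.2 W.3
  have hz' : closure {z} = (Z : Set X) := hz
  have hw' : closure {w} = (W : Set X) := hw
  refine ⟨w, z, ?_, ?_⟩
  · rw [specializes_iff_closure_subset, hz', hw']
    exact hlt.le
  · rw [specializes_iff_closure_subset, hz', hw']
    exact not_le_of_gt hlt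

/-- A homogeneous prime of `k[X]` is contained in the irrelevant maximal ideal. -/
theorem asIdeal_le_irrelevant (x : ProjectiveSpectrum (homogeneousSubmodule σ k)) :
    x.asHomogeneousIdeal.toIdeal ≤ RingHom.ker (constantCoeff : MvPolynomial σ k →+* k) := by
  intro a ha
  rw [RingHom.mem_ker]
  by_contra h
  have h0 := x.asHomogeneousIdeal.isHomogeneous 0 ha
  have h1 : (DirectSum.decompose (homogeneousSubmodule σ k) a 0 : MvPolynomial σ k)
      = C (coeff 0 a) := by
    rw [← homogeneousComponent_zero]
    exact decomposition.decompose'_apply a 0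
  rw [h1] at h0
  exact x.isPrime.ne_top (Ideal.eq_top_of_isUnit_mem _ h0
    ((isUnit_iff_ne_zero.mpr h).map C))

/-- Generic points of a chain of irreducible closed sets give homogeneous primes `x < y` above `J`,
and `y` lies strictly below the irrelevant ideal, of height at most 3. Hence `J.height + 2 ≤ 3`,
while `J ≠ ⊥` excludes height 0. -/
theorem height_eq_one_of_topologicalKrullDim {k : Type*} [Field k]
    {J : Ideal (MvPolynomial (Fin 3) k)} (hJ : J ≠ ⊥)
    (h : topologicalKrullDim (ProjectiveSpectrum.zeroLocus (homogeneousSubmodule (Fin 3) k)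
      (J : Set (MvPolynomial (Fin 3) k))) = 1) : J.height = 1 := by
  set 𝒜 := homogeneousSubmodule (Fin 3) k
  have hcl : IsClosed (ProjectiveSpectrum.zeroLocus 𝒜 (J : Set (MvPolynomial (Fin 3) k))) :=
    ProjectiveSpectrum.isClosed_zeroLocus 𝒜 _
  have := hcl.isClosedEmbedding_subtypeVal.quasiSober
  obtain ⟨x, y, hxy, hyx⟩ := exists_lt_of_one_le_topologicalKrullDim h.ge
  rw [subtype_specializes_iff, specializes_iff_mem_closure,
    ← ProjectiveSpectrum.le_iff_mem_closure] at hxy hyx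
  have hlt : x.1.asHomogeneousIdeal.toIdeal < y.1.asHomogeneousIdeal.toIdeal :=
    lt_of_le_not_ge hxy hyx
  set m := RingHom.ker (constantCoeff : MvPolynomial (Fin 3) k →+* k)
  have hm : m.IsPrime := RingHom.ker_isPrime _
  have hlt2 : y.1.asHomogeneousIdeal.toIdeal < m := by
    refine lt_of_le_of_ne (asIdeal_le_irrelevant y.1) fun e => y.1.not_irrelevant_le ?_
    change (HomogeneousIdeal.irrelevant 𝒜).toIdeal ≤ y.1.asHomogeneousIdeal.toIdeal
    rw [e]
    intro a ha
    have ha' : homogeneousComponent 0 a = 0 :=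
      (decomposition.decompose'_apply a 0).symm.trans ha
    rw [homogeneousComponent_zero, C_eq_zero] at ha'
    exact ha'
  have hx := x.1.isPrime
  have hy := y.1.isPrime
  have hle : J ≤ x.1.asHomogeneousIdeal.toIdeal := x.2
  have h3 : m.height ≤ 3 := by
    have h4 := Ideal.height_le_ringKrullDim_of_isPrime (I := m)
    rw [MvPolynomial.ringKrullDim_of_isNoetherianRing, ringKrullDim_eq_zero_of_field] at h4
    simp only [Nat.card_eq_fintype_card, Fintype.card_fin, zero_add] at h4
    exact WithBot.coe_le_coe.mp h4
  have i1 := (Ideal.height_add_one_le_of_lt_of_isPrime hlt2).trans h3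
  have i2 := (add_le_add_left (Ideal.height_add_one_le_of_lt_of_isPrime hlt) 1).trans i1
  have i3 : J.height + 1 + 1 ≤ 3 :=
    le_trans (add_le_add_left (add_le_add_left (Ideal.height_mono hle) 1) 1) i2
  have i4 : J.height ≠ 0 := fun h0 => hJ (Ideal.height_eq_zero_iff_eq_bot.mp h0)
  generalize J.height = n at i3 i4
  cases n with
  | top => exact absurd i3 (by decide)
  | coe n =>
    norm_cast at i3 i4 ⊢
    omega

end Dimension
end RationalMapFibers

namespace RationalMapFibers

/-! ### Unmixed parts and greatest common divisors in factorial rings. -/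

section Unmixed

variable {R : Type*} [CommRing R] [IsDomain R] [UniqueFactorizationMonoid R]

/-- A nonzero ideal of a factorial ring has a greatest common divisor `g`: no prime divides all the
elements of the ideal quotient by `g`. -/
theorem exists_gcd_of_ideal {R : Type*} [CommRing R] [UniqueFactorizationMonoid R] {J : Ideal R} (hJ : J ≠ ⊥) :
    ∃ g : R, g ≠ 0 ∧ (∀ a ∈ J, g ∣ a) ∧ ∀ q, Prime q → ∃ b, g * b ∈ J ∧ ¬ q ∣ b := by
  obtain ⟨a₀, ha₀, hne⟩ := Submodule.exists_mem_ne_zero_of_ne_bot hJ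
  -- A greatest common divisor is a common divisor `g` whose cofactor `c` in a fixed nonzero `a₀ ∈
  -- J` is minimal for strict divisibility.
  obtain ⟨c, ⟨g, hg, hgc⟩, hmin⟩ := (IsWellFounded.wf (r := DvdNotUnit (α := R))).has_min
    {c | ∃ g : R, (∀ a ∈ J, g ∣ a) ∧ g * c = a₀} ⟨a₀, 1, fun a _ => one_dvd a, one_mul a₀⟩
  have hg0 : g ≠ 0 := left_ne_zero_of_mul (hgc ▸ hne)
  refine ⟨g, hg0, hg, fun q hq => ?_⟩
  by_contra! hcon
  obtain ⟨c', rfl⟩ := hcon c (hgc ▸ ha₀)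
  refine hmin c' ⟨g * q, fun a ha => ?_, by rw [← hgc, mul_assoc]⟩ ⟨?_, q, hq.not_isUnit, mul_comm _ _⟩
  · obtain ⟨b, rfl⟩ := hg a ha
    exact mul_dvd_mul_left g (hcon b ha)
  · rintro rfl
    exact hne (by rw [← hgc, mul_zero, mul_zero])

theorem mem_unmixedPart_iff {R : Type*} [CommRing R] {J : Ideal R} {x : R} :
    x ∈ unmixedPart J ↔ ∀ P : Ideal R, P.IsPrime → P ∈ J.minimalPrimes → P.height = J.height →
      ∃ s ∉ P, s * x ∈ J := by
  simp only [unmixedPart, Ideal.mem_iInf, Ideal.mem_comap]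
  constructor
  · intro h P hP h1 h2
    obtain ⟨s, hs, hsx⟩ := (IsLocalization.algebraMap_mem_map_algebraMap_iff P.primeCompl
      (Localization.AtPrime P) J x).mp (h ⟨⟨P, hP⟩, h1, h2⟩)
    exact ⟨s, hs, hsx⟩
  · rintro h ⟨⟨P, hP⟩, h1, h2⟩
    obtain ⟨s, hs, hsx⟩ := h P hP h1 h2
    exact (IsLocalization.algebraMap_mem_map_algebraMap_iff P.primeCompl
      (Localization.AtPrime P) J x).mpr ⟨s, hs, hsx⟩

theorem height_span_prime {R : Type*} [CommRing R] [IsDomain R] [IsNoetherianRing R] {q : R} (hq : Prime q) :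
    (Ideal.span {q}).height = 1 := by
  have hP : (Ideal.span {q}).IsPrime := (Ideal.span_singleton_prime hq.ne_zero).mpr hq
  refine le_antisymm (Ideal.height_le_one_of_isPrincipal_of_mem_minimalPrimes (Ideal.span {q}) _
    ?_) (Order.one_le_iff_pos.mpr (pos_iff_ne_zero.mpr fun h => ?_))
  · rw [Ideal.minimalPrimes_eq_subsingleton_self]
    rfl
  · exact hq.ne_zero (Ideal.span_singleton_eq_bot.mp (Ideal.height_eq_zero_iff_eq_bot.mp h))

/-- In a factorial ring, the unmixed part of an ideal of height one is generated by the greatest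
common divisor of the ideal. -/
theorem exists_unmixedPart_eq_span [IsNoetherianRing R] {J : Ideal R} (hJ : J.height = 1) :
    ∃ g : R, g ≠ 0 ∧ ¬ IsUnit g ∧ (∀ a ∈ J, g ∣ a) ∧ Ideal.span {g} = unmixedPart J := by
  obtain ⟨g, hg0, hg, hprime⟩ := exists_gcd_of_ideal (Ideal.ne_bot_of_height_eq_one hJ)
  have hspan : ∀ P : Ideal R, P.IsPrime → P.height = 1 → ∃ q, Prime q ∧ P = Ideal.span {q} := by
    intro P hP h1
    obtain ⟨q, hqP, hq⟩ := hP.exists_mem_prime_of_ne_bot (Ideal.ne_bot_of_height_eq_one h1)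
    exact ⟨q, hq, Ideal.eq_span_singleton_of_height_eq_one h1 hqP hq⟩
  refine ⟨g, hg0, fun hu => ?_, hg, le_antisymm ?_ fun x hx => ?_⟩
  · obtain ⟨P, hP, hPJ, hP1⟩ := Ideal.exists_isPrime_height_eq (n := 1) hJ
    obtain ⟨q, hq, rfl⟩ := hspan P hP hP1
    obtain ⟨b, hb, hqb⟩ := hprime q hq
    have := Ideal.mem_span_singleton.mp (hPJ hb)
    exact hqb ((hq.dvd_mul.mp this).resolve_left fun h => hq.not_isUnit (isUnit_of_dvd_unit h hu))
  · rw [Ideal.span_singleton_le_iff_mem, mem_unmixedPart_iff]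
    intro P hP _ h1
    obtain ⟨q, hq, rfl⟩ := hspan P hP (h1.trans hJ)
    obtain ⟨b, hb, hqb⟩ := hprime q hq
    exact ⟨b, fun h => hqb (Ideal.mem_span_singleton.mp h), by rwa [mul_comm]⟩
  · rw [Ideal.mem_span_singleton]
    rw [mem_unmixedPart_iff] at hx
    -- After cancelling the common part `c`, a prime `q` dividing `g'` would generate a minimal
    -- prime of `J`; then `s * x ∈ J` with `q ∤ s` forces `q ∣ x'`, against coprimality.
    obtain ⟨g', x', c, hrel, rfl, rfl⟩ :=
      UniqueFactorizationMonoid.exists_reduced_factors g hg0 x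
    have hc := left_ne_zero_of_mul hg0
    have hu : IsUnit g' := by
      by_contra hnu
      obtain ⟨q, hqi, hqg⟩ := WfDvdMonoid.exists_irreducible_factor hnu (right_ne_zero_of_mul hg0)
      have hq := hqi.prime
      have hP : (Ideal.span {q}).IsPrime := (Ideal.span_singleton_prime hq.ne_zero).mpr hq
      have h1 := height_span_prime hq
      have hle : J ≤ Ideal.span {q} := fun a ha =>
        Ideal.mem_span_singleton.mpr ((hqg.mul_left c).trans (hg a ha))
      have hfin : (Ideal.span {q}).FiniteHeight := by simp [Ideal.finiteHeight_iff, h1]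
      obtain ⟨s, hs, hsx⟩ := hx _ hP
        (Ideal.mem_minimalPrimes_of_height_le hle (h1.trans hJ.symm).le) (h1.trans hJ.symm)
      have hd := hg _ hsx
      rw [mul_left_comm] at hd
      have hd' := hqg.trans ((mul_dvd_mul_iff_left hc).mp hd)
      rcases hq.dvd_mul.mp hd' with h | h
      · exact hs (Ideal.mem_span_singleton.mpr h)
      · exact hq.not_isUnit (hrel hqg h)
    exact mul_dvd_mul_left c hu.dvd

end Unmixed

end RationalMapFibers

namespace RationalMapFibers

open MvPolynomial LinearAlgebra.Projectivization

/-! ### Elements of the fiber ideals. -/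

section FiberIdeal

variable {k σ ι : Type*} [Field k]

/-- This is the Koszul relation `f_j T_i - f_i T_j` of the Rees algebra, specialized at `T = y`. -/
theorem sub_mem_fiberIdeal (f : ι → MvPolynomial σ k) (y : ℙ k (ι → k)) (i j : ι) :
    C (y.rep i) * f j - C (y.rep j) * f i ∈ fiberIdeal f y := by
  have hy : fiberIdeal f y = specializedIdeal f y.rep := by
    conv_lhs => rw [← y.mk_rep]
    rfl
  have hG : C (f j) * X i - C (f i) * X j ∈ reesIdeal f := by
    rw [reesIdeal, RingHom.mem_ker]
    simp only [map_sub, map_mul, aeval_X, ← algebraMap_eq, AlgHom.commutes,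
      Polynomial.algebraMap_apply, Algebra.algebraMap_self, RingHom.id_apply]
    ring
  have h := Ideal.mem_map_of_mem (specialize y.rep) hG
  rw [hy]
  convert! h using 1
  simp only [specialize, map_sub, map_mul, eval_C, eval_X]
  ring

theorem exists_rep_ne_zero (y : ℙ k (ι → k)) : ∃ i, y.rep i ≠ 0 :=
  Function.ne_iff.mp y.rep_nonzero

/-- Two distinct points of projective space have a nonzero `2 × 2` minor of coordinates. -/
theorem exists_minor_ne_zero {y z : ℙ k (ι → k)} (h : y ≠ z) :
    ∃ i j, y.rep i * z.rep j - y.rep j * z.rep i ≠ 0 := by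
  by_contra! hcon
  apply h
  obtain ⟨i, hi⟩ := exists_rep_ne_zero z
  rw [← y.mk_rep, ← z.mk_rep, Projectivization.mk_eq_mk_iff']
  refine ⟨y.rep i / z.rep i, funext fun j => ?_⟩
  have := hcon i j
  rw [Pi.smul_apply, smul_eq_mul]
  field_simp
  linear_combination this

/-- A polynomial dividing the fiber ideals of two distinct points divides the base ideal. -/
theorem dvd_of_dvd_fiberIdeal {f : ι → MvPolynomial σ k} {y z : ℙ k (ι → k)} (hyz : y ≠ z)
    {q : MvPolynomial σ k} (hy : ∀ a ∈ fiberIdeal f y, q ∣ a) (hz : ∀ a ∈ fiberIdeal f z, q ∣ a)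
    (l : ι) : q ∣ f l := by
  have cancel : ∀ (c : k) (a : MvPolynomial σ k), c ≠ 0 → q ∣ C c * a → q ∣ a := by
    intro c a hc h
    exact ((isUnit_iff_ne_zero.mpr hc).map C).dvd_mul_left.mp h
  obtain ⟨i, j, hij⟩ := exists_minor_ne_zero hyz
  have A := hy _ (sub_mem_fiberIdeal f y i j)
  have B := hz _ (sub_mem_fiberIdeal f z i j)
  -- Cramer's rule: eliminating `f j` from `A` and `B` leaves the nonzero minor times `f i`;
  -- symmetrically for `f j` below.
  have hi : q ∣ f i := by
    apply cancel _ _ hij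
    convert! (A.mul_left (C (z.rep i))).sub (B.mul_left (C (y.rep i))) using 1
    simp only [map_sub, map_mul]
    ring
  have hj : q ∣ f j := by
    apply cancel _ _ hij
    convert! (A.mul_left (C (z.rep j))).sub (B.mul_left (C (y.rep j))) using 1
    simp only [map_sub, map_mul]
    ring
  have aux : ∀ m, q ∣ f m → y.rep m ≠ 0 → q ∣ f l := by
    intro m hm hy0
    apply cancel _ _ hy0
    have := (hy _ (sub_mem_fiberIdeal f y m l)).add (hm.mul_left (C (y.rep l)))
    rwa [sub_add_cancel] at this
  by_cases h0 : y.rep i = 0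
  · refine aux j hj fun h1 => hij (by rw [h0, h1]; ring)
  · exact aux i hi h0

/-- A nonzero scalar coefficient is a unit, so its generator would be redundant. -/
theorem eq_zero_of_sum_C_mul {f : ι → MvPolynomial σ k} [Fintype ι]
    (hmin : IsMinimalGeneratingSet f) {c : ι → k} (h : ∑ i, C (c i) * f i = 0) : c = 0 := by
  classical
  by_contra hc
  obtain ⟨i, hi⟩ := Function.ne_iff.mp hc
  apply hmin i
  rw [← Finset.add_sum_erase _ _ (Finset.mem_univ i)] at h
  have hu : IsUnit (C (c i) : MvPolynomial σ k) := (isUnit_iff_ne_zero.mpr hi).map C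
  rw [← (Ideal.span (f '' {i}ᶜ)).unit_mul_mem_iff_mem hu, eq_neg_of_add_eq_zero_left h]
  refine Submodule.neg_mem _ (Submodule.sum_mem _ fun j hj => Ideal.mul_mem_left _ _
    (Ideal.subset_span ⟨j, Finset.ne_of_mem_erase hj, rfl⟩))

/-- Such an element shows that the fiber ideal is nonzero, and makes its gcd homogeneous as a
divisor of a nonzero form. -/
theorem exists_isHomogeneous_mem_fiberIdeal [Fintype ι] [Nontrivial ι]
    {f : ι → MvPolynomial σ k} {d : ℕ}
    (hf : ∀ i, (f i).IsHomogeneous d) (hmin : IsMinimalGeneratingSet f) (y : ℙ k (ι → k)) :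
    ∃ a ∈ fiberIdeal f y, a ≠ 0 ∧ a.IsHomogeneous d := by
  classical
  obtain ⟨i, hi⟩ := exists_rep_ne_zero y
  obtain ⟨j, hj⟩ := exists_ne i
  refine ⟨_, sub_mem_fiberIdeal f y i j, fun h => ?_, ((hf j).C_mul _).sub ((hf i).C_mul _)⟩
  have := eq_zero_of_sum_C_mul (c := Pi.single j (y.rep i) - Pi.single i (y.rep j)) hmin (by
    simp only [Pi.sub_apply, map_sub, sub_mul, Finset.sum_sub_distrib, Pi.single_apply,
      apply_ite C, map_zero, ite_mul, zero_mul, Finset.sum_ite_eq', Finset.mem_univ, if_true]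
    exact h)
  have h1 := congrFun this j
  simp [hj, hi] at h1

end FiberIdeal

/-! ### Equations of the one-dimensional fibers. -/

section UnmixedEquation

/-- A common prime factor `q` would divide every `f l`, placing an ideal of height two inside `(q)`,
of height one. -/
theorem isRelPrime_of_dvd_fiberIdeal {k : Type*} [Field k] {ι : Type*}
    {f : ι → MvPolynomial (Fin 3) k} {y z : ℙ k (ι → k)} (hcodim : (baseIdeal f).height = 2)
    (hyz : y ≠ z) {g h : MvPolynomial (Fin 3) k} (hg0 : g ≠ 0) (hg : ∀ a ∈ fiberIdeal f y, g ∣ a)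
    (hh : ∀ a ∈ fiberIdeal f z, h ∣ a) : IsRelPrime g h := by
  intro c hcg hch
  by_contra hu
  obtain ⟨q, hqi, hqc⟩ := WfDvdMonoid.exists_irreducible_factor hu
    (ne_zero_of_dvd_ne_zero hg0 hcg)
  have hle : baseIdeal f ≤ Ideal.span {q} := by
    rw [baseIdeal, Ideal.span_le]
    rintro _ ⟨l, rfl⟩
    exact Ideal.mem_span_singleton.mpr (dvd_of_dvd_fiberIdeal hyz
      (fun a ha => (hqc.trans hcg).trans (hg a ha))
      (fun a ha => (hqc.trans hch).trans (hh a ha)) l)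
  have := Ideal.height_mono hle
  rw [hcodim, height_span_prime hqi.prime] at this
  exact absurd this (by decide)

variable {k : Type*} [Field k] {ι : Type*} [Fintype ι] [Nontrivial ι]
  {f : ι → MvPolynomial (Fin 3) k} {d : ℕ} {y : ℙ k (ι → k)}

theorem exists_isUnmixedEquation (hf : ∀ i, (f i).IsHomogeneous d)
    (hmin : IsMinimalGeneratingSet f) (hy : y ∈ pointsWithFiberDim f 1) :
    ∃ g, g ≠ 0 ∧ g.IsHomogeneous g.totalDegree ∧ g.totalDegree ≠ 0 ∧
      (∀ a ∈ fiberIdeal f y, g ∣ a) ∧ IsUnmixedEquation f y g := by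
  obtain ⟨a, ha, ha0, had⟩ := exists_isHomogeneous_mem_fiberIdeal hf hmin y
  have hJ : fiberIdeal f y ≠ ⊥ := fun h => ha0 (by rwa [h, Ideal.mem_bot] at ha)
  obtain ⟨g, hg0, hgu, hg, hgs⟩ := exists_unmixedPart_eq_span
    (height_eq_one_of_topologicalKrullDim hJ (hy.out.trans Nat.cast_one))
  exact ⟨g, hg0, isHomogeneous_of_dvd had ha0 (hg a ha),
    fun h => hgu (isUnit_of_totalDegree_eq_zero hg0 h), hg, hgs⟩

theorem IsUnmixedEquation.dvd_and_totalDegree_ne_zero {h : MvPolynomial (Fin 3) k}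
    (hh : IsUnmixedEquation f y h) (hf : ∀ i, (f i).IsHomogeneous d)
    (hmin : IsMinimalGeneratingSet f) (hy : y ∈ pointsWithFiberDim f 1) :
    (∀ a ∈ fiberIdeal f y, h ∣ a) ∧ h ≠ 0 ∧ h.totalDegree ≠ 0 := by
  obtain ⟨g, hg0, -, hgd, hg, hgs⟩ := exists_isUnmixedEquation hf hmin hy
  have e : Associated h g := Ideal.span_singleton_eq_span_singleton.mp (hh.trans hgs.symm)
  refine ⟨fun a ha => e.dvd.trans (hg a ha), e.symm.ne_zero_iff.mp hg0, fun h0 => hgd ?_⟩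
  have := totalDegree_le_of_dvd_of_isDomain e.symm.dvd (e.symm.ne_zero_iff.mp hg0)
  omega

end UnmixedEquation

end RationalMapFibers

namespace RationalMapFibers

open MvPolynomial LinearAlgebra.Projectivization

/-! ### Maximal minors of the Jacobian matrix. -/

section Minors

/-- The signed maximal minors of a `4 × 3` matrix. -/
def signedMinor {R : Type*} [CommRing R] (M : Matrix (Fin 4) (Fin 3) R) (i : Fin 4) : R :=
  (-1) ^ (i : ℕ) * (M.submatrix i.succAbove id).det

/-- Laplace expansion of the `4 × 4` determinant obtained by repeating column `j` in front of `M`.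
-/
theorem sum_signedMinor_mul {R : Type*} [CommRing R] (M : Matrix (Fin 4) (Fin 3) R) (j : Fin 3) :
    ∑ i, signedMinor M i * M i j = 0 := by
  have h := Matrix.det_succ_column_zero (Matrix.of fun i (l : Fin 4) => M i ((Fin.cons j id : Fin 4 → Fin 3) l))
  rw [Matrix.det_zero_of_column_eq (i := 0) (j := j.succ) (Fin.succ_ne_zero j).symm
    (fun i => by simp)] at h
  rw [h]
  refine Finset.sum_congr rfl fun i _ => ?_
  rw [signedMinor, mul_right_comm]
  rfl

theorem exists_signedMinor_ne_zero {R : Type*} [CommRing R] {M : Matrix (Fin 4) (Fin 3) R}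
    (h : minorsIdeal 3 M ≠ ⊥) : ∃ i, signedMinor M i ≠ 0 := by
  by_contra! hcon
  apply h
  rw [minorsIdeal, Ideal.span_eq_bot]
  rintro _ ⟨⟨r, c⟩, rfl⟩
  obtain ⟨i, hi⟩ : ∃ i, i ∉ Set.range r := by
    by_contra! hs
    have := Fintype.card_le_of_surjective r hs
    simp at this
  have hr : ∀ a, ∃ b, i.succAbove b = r a := fun a =>
    Fin.exists_succAbove_eq fun e => hi ⟨a, e⟩
  choose s hs using hr
  have hsi : Function.Injective s := fun a b hab => r.injective (by rw [← hs a, ← hs b, hab])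
  let s' : Equiv.Perm (Fin 3) := Equiv.ofBijective s (Finite.injective_iff_bijective.mp hsi)
  let c' : Equiv.Perm (Fin 3) := Equiv.ofBijective c (Finite.injective_iff_bijective.mp c.injective)
  have e : M.submatrix r c = ((M.submatrix i.succAbove id).submatrix s' id).submatrix id c' := by
    ext a b
    simp [s', c', hs]
  have h0 := hcon i
  rw [signedMinor, (isUnit_one.neg.pow _).mul_right_eq_zero] at h0
  simp only
  rw [e, Matrix.det_permute', Matrix.det_permute, h0, mul_zero, mul_zero]

/-- Modulo `h` the `3 × 3` matrix is a sum of two rank-one matrices, hence singular. -/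
theorem dvd_det_of_eq_add {R : Type*} [CommRing R] {h : R} {c g u w : Fin 3 → R}
    {N : Matrix (Fin 3) (Fin 3) R} (hN : ∀ i j, h ∣ N i j - (c i * u j + g i * w j)) :
    h ∣ N.det := by
  rw [← Ideal.mem_span_singleton, ← Ideal.Quotient.eq_zero_iff_mem]
  have e : ∀ i j, Ideal.Quotient.mk (Ideal.span {h}) (N i j)
      = Ideal.Quotient.mk (Ideal.span {h}) (c i * u j + g i * w j) := fun i j =>
    Ideal.Quotient.eq.mpr (Ideal.mem_span_singleton.mpr (hN i j))
  rw [Matrix.det_fin_three]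
  simp only [map_sub, map_add, map_mul, e]
  ring

theorem isHomogeneous_det {k σ : Type*} [Field k] {n e : ℕ}
    {N : Matrix (Fin n) (Fin n) (MvPolynomial σ k)} (hN : ∀ i j, (N i j).IsHomogeneous e) :
    N.det.IsHomogeneous (n * e) := by
  rw [Matrix.det_apply]
  refine IsHomogeneous.sum _ _ _ fun s _ => ?_
  have := IsHomogeneous.prod Finset.univ (fun i => N (s i) i) (fun _ => e) fun i _ => hN _ _
  simp only [Finset.sum_const, Finset.card_univ, Fintype.card_fin, smul_eq_mul] at this
  rcases Int.units_eq_one_or (Equiv.Perm.sign s) with h | h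
  · rwa [h, one_smul]
  · rw [h, Units.neg_smul, one_smul]
    exact this.neg

variable {k : Type*} [Field k] {f : Fin 4 → MvPolynomial (Fin 3) k} {d : ℕ}

theorem isHomogeneous_signedMinor_jacobian (hf : ∀ i, (f i).IsHomogeneous d) (i : Fin 4) :
    (signedMinor (jacobian f) i).IsHomogeneous (3 * (d - 1)) := by
  have h : ((jacobian f).submatrix i.succAbove id).det.IsHomogeneous (3 * (d - 1)) :=
    isHomogeneous_det fun a b => (hf _).pderiv
  rw [signedMinor]
  rcases neg_one_pow_eq_or (MvPolynomial (Fin 3) k) (i : ℕ) with e | e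
  · rwa [e, one_mul]
  · rw [e, neg_one_mul]
    exact h.neg

/-- A polynomial dividing the fiber ideal of a point divides the maximal minors of the Jacobian
matrix: modulo such a polynomial the Jacobian matrix has rank at most two. -/
theorem dvd_signedMinor_jacobian {y : ℙ k (Fin 4 → k)} {h : MvPolynomial (Fin 3) k}
    (hh : ∀ a ∈ fiberIdeal f y, h ∣ a) (i : Fin 4) : h ∣ signedMinor (jacobian f) i := by
  obtain ⟨m, hm⟩ := exists_rep_ne_zero y
  have key : ∀ l, ∃ g, C (y.rep m) * f l = C (y.rep l) * f m + h * g := by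
    intro l
    obtain ⟨g, hg⟩ := hh _ (sub_mem_fiberIdeal f y m l)
    exact ⟨g, by rw [← hg]; ring⟩
  choose g hg using key
  refine Dvd.dvd.mul_left ?_ _
  have hinv : C (y.rep m)⁻¹ * C (y.rep m) = (1 : MvPolynomial (Fin 3) k) := by
    rw [← C_mul, inv_mul_cancel₀ hm, C_1]
  -- The two rank-one terms come from the product rule applied to `y_m f_l = y_l f_m + h g_l`: the
  -- gradients of `f_m` and of `h`. The remaining term `h ∂g_l` vanishes modulo `h`.
  refine dvd_det_of_eq_add (c := fun a => C (y.rep m)⁻¹ * C (y.rep (i.succAbove a)))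
    (u := fun b => pderiv b (f m)) (g := fun a => C (y.rep m)⁻¹ * g (i.succAbove a))
    (w := fun b => pderiv b h) fun a b => ?_
  refine ⟨C (y.rep m)⁻¹ * pderiv b (g (i.succAbove a)), ?_⟩
  have e := congrArg (pderiv b) (hg (i.succAbove a))
  simp only [map_add, pderiv_mul, pderiv_C, zero_mul, zero_add] at e
  simp only [Matrix.submatrix_apply, id, jacobian, Matrix.of_apply]
  linear_combination C (y.rep m)⁻¹ * e - pderiv b (f (i.succAbove a)) * hinv

theorem sum_signedMinor_jacobian_mul (hf : ∀ i, (f i).IsHomogeneous d) (hd : ¬ ringChar k ∣ d) :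
    ∑ i, signedMinor (jacobian f) i * f i = 0 := by
  have hd0 : (d : k) ≠ 0 := fun h => hd ((ringChar.spec k d).mp h)
  have hu : (C (d : k) : MvPolynomial (Fin 3) k) ≠ 0 := by rwa [Ne, C_eq_zero]
  refine (mul_eq_zero.mp ?_).resolve_left hu
  have e : ∀ i, C (d : k) * f i = ∑ j, X j * pderiv j (f i) := fun i => by
    rw [(hf i).sum_X_mul_pderiv, nsmul_eq_mul, map_natCast]
  rw [Finset.mul_sum]
  simp_rw [mul_left_comm (C (d : k)), e, Finset.mul_sum]
  rw [Finset.sum_comm]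
  refine Finset.sum_eq_zero fun j _ => ?_
  simp_rw [mul_left_comm _ (X j), ← Finset.mul_sum]
  rw [show ∑ i, signedMinor (jacobian f) i * pderiv j (f i) = 0 from
    sum_signedMinor_mul (jacobian f) j, mul_zero]

end Minors

/-! ### Initial degree of the syzygies. -/

section Syzygies

variable {k σ ι : Type*} [Field k] [Fintype ι] {f : ι → MvPolynomial σ k}

theorem mem_syzygyPart_iff {ν : ℕ} {a : ι → MvPolynomial σ k} :
    a ∈ syzygyPart f ν ↔ ∑ i, a i * f i = 0 ∧ ∀ i, (a i).IsHomogeneous ν := by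
  simp [syzygyPart, Fintype.linearCombination_apply, Submodule.mem_pi]

theorem indeg_syzygyPart_le {ν : ℕ} {a : ι → MvPolynomial σ k} (ha : a ∈ syzygyPart f ν)
    (h0 : a ≠ 0) : indeg (syzygyPart f) ≤ ν :=
  iInf₂_le ν fun h => h0 (by rwa [h, Submodule.mem_bot] at ha)

theorem indeg_syzygyPart_ne_zero (hmin : IsMinimalGeneratingSet f) :
    indeg (syzygyPart f) ≠ 0 := by
  refine (Order.one_le_iff_pos.mp (le_iInf₂ fun ν hν => ?_)).ne'
  rw [← Nat.cast_one, Nat.cast_le, Nat.one_le_iff_ne_zero]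
  rintro rfl
  refine hν ((Submodule.eq_bot_iff _).mpr fun a ha => ?_)
  obtain ⟨h1, h2⟩ := mem_syzygyPart_iff.mp ha
  have h3 : ∀ i, a i = C (coeff 0 (a i)) := fun i =>
    totalDegree_eq_zero_iff_eq_C.mp (Nat.le_zero.mp (h2 i).totalDegree_le)
  have h4 := eq_zero_of_sum_C_mul (c := fun i => coeff 0 (a i)) hmin (by
    simp_rw [← h3]
    exact h1)
  funext i
  rw [h3, show coeff 0 (a i) = 0 from congrFun h4 i, C_0]
  rfl

end Syzygies

/-! ### The degree bound and finiteness. -/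

section DegreeBound

theorem totalDegree_prod {k σ ι : Type*} [Field k] {S : Finset ι} {h : ι → MvPolynomial σ k}
    (h0 : ∀ y ∈ S, h y ≠ 0) : (∏ y ∈ S, h y).totalDegree = ∑ y ∈ S, (h y).totalDegree := by
  classical
  induction S using Finset.induction_on with
  | empty => simp
  | insert a S ha ih =>
    rw [Finset.forall_mem_insert] at h0
    rw [Finset.prod_insert ha, Finset.sum_insert ha,
      totalDegree_mul_of_isDomain h0.1 (Finset.prod_ne_zero_iff.mpr h0.2), ih h0.2]

variable {k : Type*} [Field k] {f : Fin 4 → MvPolynomial (Fin 3) k} {d : ℕ}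

/-- The witness is the signed minors divided by `∏ h y`. Allowing any finite `S` lets finiteness of
the set of points be a consequence, and additive form in `ℕ∞` lets finiteness of `indeg` be one too.
-/
theorem sum_totalDegree_add_indeg_le (hf : ∀ i, (f i).IsHomogeneous d)
    (hmin : IsMinimalGeneratingSet f) (hcodim : (baseIdeal f).height = 2)
    (hJ : minorsIdeal 3 (jacobian f) ≠ ⊥) (hd : ¬ ringChar k ∣ d)
    (S : Finset (ℙ k (Fin 4 → k))) (hS : ∀ y ∈ S, y ∈ pointsWithFiberDim f 1)
    (h : ℙ k (Fin 4 → k) → MvPolynomial (Fin 3) k) (hh : ∀ y ∈ S, IsUnmixedEquation f y (h y)) :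
    (∑ y ∈ S, (h y).totalDegree : ℕ) + indeg (syzygyPart f) ≤ (3 * (d - 1) : ℕ) := by
  have hprop := fun y hy => (hh y hy).dvd_and_totalDegree_ne_zero hf hmin (hS y hy)
  obtain ⟨m, hm⟩ := exists_signedMinor_ne_zero hJ
  have hdvd : ∀ i, ∏ y ∈ S, h y ∣ signedMinor (jacobian f) i := fun i =>
    Finset.prod_dvd_of_isRelPrime (fun y hy z hz hyz => isRelPrime_of_dvd_fiberIdeal hcodim hyz
      (hprop y hy).2.1 (hprop y hy).1 (hprop z hz).1)
      fun y hy => dvd_signedMinor_jacobian (hprop y hy).1 i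
  have hH0 : ∏ y ∈ S, h y ≠ 0 := ne_zero_of_dvd_ne_zero hm (hdvd m)
  have hdeg : (∏ y ∈ S, h y).totalDegree = ∑ y ∈ S, (h y).totalDegree :=
    totalDegree_prod fun y hy => (hprop y hy).2.1
  set H := ∏ y ∈ S, h y
  choose b hb using hdvd
  have hhom := isHomogeneous_signedMinor_jacobian hf
  have hbm : b m ≠ 0 := right_ne_zero_of_mul (hb m ▸ hm)
  have hbd : ∀ i, b i ≠ 0 → H.totalDegree + (b i).totalDegree = 3 * (d - 1) := by
    intro i hi
    rw [← totalDegree_mul_of_isDomain hH0 hi, ← hb,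
      (hhom i).totalDegree (hb i ▸ mul_ne_zero hH0 hi)]
  have hmem : b ∈ syzygyPart f (b m).totalDegree := by
    refine mem_syzygyPart_iff.mpr ⟨?_, fun i => ?_⟩
    · refine (mul_eq_zero.mp ?_).resolve_left hH0
      rw [← sum_signedMinor_jacobian_mul hf hd, Finset.mul_sum]
      simp_rw [hb, mul_assoc]
    · by_cases hi : b i = 0
      · rw [hi]
        exact isHomogeneous_zero _ _ _
      · have := isHomogeneous_of_dvd (hhom i) (hb i ▸ mul_ne_zero hH0 hi) (hb i ▸ dvd_mul_left _ _)
        rwa [show (b m).totalDegree = (b i).totalDegree by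
          have := hbd i hi
          have := hbd m hbm
          omega]
  rw [← hdeg, ← hbd m hbm, Nat.cast_add]
  gcongr
  exact indeg_syzygyPart_le hmem fun h0 => hbm (congrFun h0 m)

theorem finite_pointsWithFiberDim_one (hf : ∀ i, (f i).IsHomogeneous d)
    (hmin : IsMinimalGeneratingSet f) (hcodim : (baseIdeal f).height = 2)
    (hJ : minorsIdeal 3 (jacobian f) ≠ ⊥) (hd : ¬ ringChar k ∣ d) :
    (pointsWithFiberDim f 1).Finite := by
  classical
  by_contra hinf
  -- Each equation has degree at least one, so one point more than `3 * (d - 1)` contradicts the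
  -- bound.
  obtain ⟨S, hS, hcard⟩ := Set.Infinite.exists_subset_card_eq hinf (3 * (d - 1) + 1)
  have hex := fun y hy => exists_isUnmixedEquation (y := y) hf hmin hy
  choose! g hg0 _ hgd _ hgs using hex
  have hle := (le_add_right le_rfl).trans
    (sum_totalDegree_add_indeg_le hf hmin hcodim hJ hd S hS g fun y hy => hgs y (hS hy))
  rw [Nat.cast_le] at hle
  have : S.card ≤ ∑ y ∈ S, (g y).totalDegree := by
    rw [Finset.card_eq_sum_ones]
    exact Finset.sum_le_sum fun y hy => Nat.one_le_iff_ne_zero.mpr (hgd y (hS hy))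
  omega

end DegreeBound

end RationalMapFibers

open RationalMapFibers
theorem corollary4p4 {k : Type*} [Field k] [IsAlgClosed k] (d : ℕ)
    (f : Fin 4 → MvPolynomial (Fin 3) k) (hf : ∀ i, (f i).IsHomogeneous d)
    (hmin : IsMinimalGeneratingSet f) (hcodim : (baseIdeal f).height = 2)
    (hJ : minorsIdeal 3 (jacobian f) ≠ ⊥) (hd : ¬ ringChar k ∣ d) :
    ∃ hfin : (pointsWithFiberDim f 1).Finite,
      (∀ y ∈ pointsWithFiberDim f 1, ∃ (e : ℕ) (h : MvPolynomial (Fin 3) k),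
        h ≠ 0 ∧ h.IsHomogeneous e ∧ IsUnmixedEquation f y h) ∧
      indeg (syzygyPart f) ≠ ⊤ ∧
      (∀ h : Projectivization k (Fin 4 → k) → MvPolynomial (Fin 3) k,
        (∀ y ∈ pointsWithFiberDim f 1, IsUnmixedEquation f y (h y)) →
        ((∑ y ∈ hfin.toFinset, (h y).totalDegree : ℕ) : ℤ) ≤
          3 * ((d : ℤ) - 1) - ((indeg (syzygyPart f)).toNat : ℤ)) ∧
      3 * ((d : ℤ) - 1) - ((indeg (syzygyPart f)).toNat : ℤ) < 3 * ((d : ℤ) - 1) := by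
  have hfin := finite_pointsWithFiberDim_one hf hmin hcodim hJ hd
  have hbound := sum_totalDegree_add_indeg_le hf hmin hcodim hJ hd
  have hne : indeg (syzygyPart f) ≠ ⊤ := by
    intro htop
    -- With no points, the bound reads `indeg ≤ 3 * (d - 1)`.
    have := hbound ∅ (by simp) 0 (by simp)
    rw [htop, add_top, top_le_iff] at this
    exact ENat.natCast_ne_top _ this
  have h0 := indeg_syzygyPart_ne_zero hmin
  obtain ⟨n, hn⟩ := ENat.ne_top_iff_exists.mp hne
  rw [← hn] at hbound h0 ⊢
  -- Needed so that the truncated `d - 1` of the bound agrees with the integer one.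
  have hd1 : 1 ≤ d := Nat.one_le_iff_ne_zero.mpr fun h => hd (h ▸ dvd_zero _)
  refine ⟨hfin, fun y hy => ?_, ENat.natCast_ne_top n, fun h hh => ?_, ?_⟩
  · obtain ⟨g, hg0, hgh, -, -, hgs⟩ := exists_isUnmixedEquation hf hmin hy
    exact ⟨_, g, hg0, hgh, hgs⟩
  · have := hbound hfin.toFinset (by simp) h (by simpa using hh)
    norm_cast at this
    rw [ENat.toNat_natCast]
    omega
  · rw [ENat.toNat_natCast]
    have : n ≠ 0 := fun h => h0 (by rw [h]; rfl)
    omega
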